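/- Let $k$ be a field and $A$ a finite-dimensional $k$-vector space with bilinear products $\succ,\prec,\ast$. Put $x\cdot y=x\succ y+x\prec y$ and $[x,y]=x\ast y-y\ast x$. For a product $\star$ write $L_\star(x)y=x\star y$, $R_\star(x)y=y\star x$, and $\mathrm{ad}(x)y=[x,y]$. Let $\tau$ be the flip of $A\otimes A$ and $I$ the identity. *Algebras.* $(A,\succ,\prec,\ast)$ is a *coherent noncommutative pre-Poisson algebra* if for all $x,y,z\in A$: $(A,\succ,\prec)$ is a dendriform algebra, i.e. $(x\prec y)\prec z=x\prec(y\cdot z)$, $(x\succ y)\prec z=x\succ(y\prec z)$, $x\succ(y\succ z)=(x\cdot y)\succ z$; $(A,\ast)$ is a pre-Lie algebra, i.e. $(x\ast y)\ast z-x\ast(y\ast z)=(y\ast x)\ast z-y\ast(x\ast z)$; and $$[x,y]\succ z=x\ast(y\succ z)-y\succ(x\ast z),\qquad x\prec[y,z]=y\ast(x\prec z)-(y\ast x)\prec z,$$ $$(x\cdot y)\ast z=(x\ast z)\prec y+x\succ(y\ast z),\qquad (x\cdot y)\ast z=x\ast(y\succ z)+y\ast(z\prec x).$$ *Coalgebras.*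 Let $\Delta_\succ,\Delta_\prec,\delta:A\to A\otimes A$ be linear and $\Delta=\Delta_\succ+\Delta_\prec$. $(A,\Delta_\succ,\Delta_\prec,\delta)$ is a *coherent noncommutative pre-Poisson coalgebra* if $$(\Delta_\succ\otimes I)\Delta_\prec=(I\otimes\Delta_\prec)\Delta_\succ,\quad (I\otimes\Delta_\succ)\Delta_\succ=(\Delta\otimes I)\Delta_\succ,\quad (\Delta_\prec\otimes I)\Delta_\prec=(I\otimes\Delta)\Delta_\prec$$ (dendriform coalgebra), $$(I\otimes\delta)\delta-(\tau\otimes I)(I\otimes\delta)\delta=(\delta\otimes I)\delta-(\tau\otimes I)(\delta\otimes I)\delta$$ (pre-Lie coalgebra), and $$(\delta\otimes I)\Delta_\succ-(\tau\otimes I)(\delta\otimes I)\Delta_\succ=(I\otimes\Delta_\succ)\delta-(\tau\otimes I)(I\otimes\delta)\Delta_\succ,$$ $$(I\otimes\delta)\Delta_\prec-(I\otimes\tau)(I\otimes\delta)\Delta_\prec=(\tau\otimes I)(I\otimes\Delta_\prec)\delta-(\tau\otimes I)(\delta\otimes I)\Delta_\prec,$$ $$(\Delta\otimes I)\delta=(I\otimes\tau)(\delta\otimes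 I)\Delta_\prec+(I\otimes\delta)\Delta_\succ,$$ $$(\Delta\otimes I)\delta=(I\otimes\Delta_\succ)\delta+(\tau\otimes I)(I\otimes\tau)(I\otimes\Delta_\prec)\delta.$$ *Bialgebras.* $(A,\succ,\prec,\ast,\Delta_\succ,\Delta_\prec,\delta)$ is a *noncommutative pre-Poisson bialgebra* if $(A,\succ,\prec,\ast)$ and $(A,\Delta_\succ,\Delta_\prec,\delta)$ are a coherent noncommutative pre-Poisson algebra and coalgebra and the following hold for all $x,y\in A$. (i) Dendriform bialgebra: $$\Delta_\prec(x\cdot y)=(I\otimes L_\succ(x))\Delta_\prec(y)+(R_\cdot(y)\otimes I)\Delta_\prec(x),$$ $$\Delta_\succ(x\cdot y)=(I\otimes L_\cdot(x))\Delta_\succ(y)+(R_\prec(y)\otimes I)\Delta_\succ(x),$$ $$\Delta(x\prec y)=(R_\prec(y)\otimes I)\Delta(x)+(I\otimes L_\prec(x))\Delta_\succ(y),$$ $$\Delta(x\succ y)=(I\otimes L_\succ(x))\Delta(y)+(R_\succ(y)\otimes I)\Delta_\prec(x),$$ $$(L_\cdot(x)\otimes I-I\otimes R_\prec(x))\Delta_\prec(y)+\tau\big((L_\succ(y)\otimes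 I-I\otimes R_\cdot(y))\Delta_\succ(x)\big)=0,$$ $$(L_\succ(x)\otimes I)\Delta(y)-(R_\succ(y)\otimes I)\tau\Delta_\succ(x)+(I\otimes L_\prec(y))\tau\Delta_\prec(x)-(I\otimes R_\prec(x))\Delta(y)=0.$$ (ii) Pre-Lie bialgebra: $$\delta([x,y])=(I\otimes\mathrm{ad}(x)+L_\ast(x)\otimes I)\delta(y)-(I\otimes\mathrm{ad}(y)+L_\ast(y)\otimes I)\delta(x),$$ $$(\delta-\tau\delta)(x\ast y)=(L_\ast(x)\otimes I+I\otimes L_\ast(x))(\delta-\tau\delta)(y)+(I\otimes R_\ast(y))\delta(x)-(R_\ast(y)\otimes I)\tau\delta(x).$$ (iii) Mixed conditions: $$\Delta(x\ast y)=(L_\ast(x)\otimes I+I\otimes L_\ast(x))\Delta(y)-(I\otimes L_\prec(y))\delta(x)-(R_\succ(y)\otimes I)\tau\delta(x),$$ $$(\delta-\tau\delta)(y\prec x)=(I\otimes R_\prec(x))(\delta-\tau\delta)(y)+(R_\ast(y)\otimes I)\tau\Delta_\succ(x)+(I\otimes L_\prec(y))\delta(x)-(L_\ast(x)\otimes I)\Delta(y),$$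 $$\delta(x\cdot y)=(I\otimes R_\cdot(y))\delta(x)+(I\otimes L_\cdot(x))\delta(y)-(L_\ast(x)\otimes I)\tau\Delta_\prec(y)-(L_\ast(y)\otimes I)\Delta_\succ(x),$$ $$\Delta_\prec([x,y])=(\mathrm{ad}(x)\otimes I)\Delta_\prec(y)+(I\otimes L_\succ(y))\tau\delta(x)+(I\otimes L_\ast(x))\Delta_\prec(y)-(R_\cdot(y)\otimes I)\tau\delta(x).$$ *Yang-Baxter equation and invariance.* An element $r=\sum_i a_i\otimes b_i\in A\otimes A$ is a solution of the *NPP-YBE* if $$\sum_{i,j}\big(a_i\cdot a_j\otimes b_i\otimes b_j-a_j\otimes a_i\succ b_j\otimes b_i-a_i\otimes a_j\otimes b_i\prec b_j\big)=0$$ and $$\sum_{i,j}\big(a_i\otimes b_i\ast a_j\otimes b_j-a_i\ast a_j\otimes b_i\otimes b_j+a_i\otimes a_j\otimes[b_i,b_j]\big)=0.$$ An element $s\in A\otimes A$ is *invariant* if for all $x\in A$ $$(I\otimes L_\cdot(x)-R_\prec(x)\otimes I)\tau(s)=0,\quad (R_\cdot(x)\otimes I-I\otimes L_\succ(x))s=0,\quad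 (L_\ast(x)\otimes I+I\otimes\mathrm{ad}(x))s=0.$$ **Theorem.** Let $(A,\succ,\prec,\ast)$ be a coherent noncommutative pre-Poisson algebra and let $r\in A\otimes A$ (not necessarily symmetric) be a solution of the NPP-YBE such that $r-\tau(r)$ is invariant. Define $$\Delta_{\succ,r}(x)=(I\otimes L_\cdot(x)-R_\prec(x)\otimes I)\tau(r),\quad \Delta_{\prec,r}(x)=(R_\cdot(x)\otimes I-I\otimes L_\succ(x))r,\quad \delta_r(x)=(L_\ast(x)\otimes I+I\otimes\mathrm{ad}(x))r.$$ Then $(A,\succ,\prec,\ast,\Delta_{\succ,r},\Delta_{\prec,r},\delta_r)$ is a noncommutative pre-Poisson bialgebra (such a bialgebra is called quasi-triangular). -/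

import Mathlib

open scoped TensorProduct

noncomputable section

namespace PrePoisson

variable {k A : Type*} [Field k] [AddCommGroup A] [Module k A]

/-! ### Algebras

A bilinear product on `A` is a map `m : A →ₗ[k] A →ₗ[k] A`, so that `m x` is the left
multiplication `L_m(x)` and `m.flip x` is the right multiplication `R_m(x)`. -/

/-- The commutator `[x, y] = x ∗ y - y ∗ x`. Thus `comm ast x` is `ad(x)`. -/
def comm (ast : A →ₗ[k] A →ₗ[k] A) : A →ₗ[k] A →ₗ[k] A := ast - ast.flip

@[simp] lemma comm_apply (ast : A →ₗ[k] A →ₗ[k] A) (x y : A) :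
    comm ast x y = ast x y - ast y x := rfl

/-- Dendriform algebras `(A, ≻, ≺)`. -/
structure IsDendriform (succ prec : A →ₗ[k] A →ₗ[k] A) : Prop where
  prec_prec : ∀ x y z, prec (prec x y) z = prec x (succ y z + prec y z)
  succ_prec : ∀ x y z, prec (succ x y) z = succ x (prec y z)
  succ_succ : ∀ x y z, succ x (succ y z) = succ (succ x y + prec x y) z

/-- (Left) pre-Lie algebras `(A, ∗)`. -/
def IsPreLie (ast : A →ₗ[k] A →ₗ[k] A) : Prop :=
  ∀ x y z, ast (ast x y) z - ast x (ast y z) = ast (ast y x) z - ast y (ast x z)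

/-- Noncommutative pre-Poisson algebras `(A, ≻, ≺, ∗)`. -/
structure IsNCPrePoisson (succ prec ast : A →ₗ[k] A →ₗ[k] A) : Prop where
  dendriform : IsDendriform succ prec
  preLie : IsPreLie ast
  comm_succ : ∀ x y z,
    succ (ast x y - ast y x) z = ast x (succ y z) - succ y (ast x z)
  prec_comm : ∀ x y z,
    prec x (ast y z - ast z y) = ast y (prec x z) - prec (ast y x) z
  dot_ast : ∀ x y z,
    ast (succ x y + prec x y) z = prec (ast x z) y + succ x (ast y z)

/-- Coherent noncommutative pre-Poisson algebras. -/
structure IsCoherentNCPrePoisson (succ prec ast : A →ₗ[k] A →ₗ[k] A) : Prop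
    extends IsNCPrePoisson succ prec ast where
  coherent : ∀ x y z,
    ast (succ x y + prec x y) z = ast x (succ y z) + ast y (prec z x)

/-! ### Operators on `A ⊗ A` and `A ⊗ A ⊗ A`

The triple tensor product is `A ⊗ (A ⊗ A)`. For `f : A → A`, the operators `f ⊗ I` and `I ⊗ f`
on `A ⊗ A` are `f.rTensor A` and `f.lTensor A`. -/

/-- The flip `τ` on `A ⊗ A`. -/
def flip2 : A ⊗[k] A →ₗ[k] A ⊗[k] A := (TensorProduct.comm k A A).toLinearMap

/-- `Δ ⊗ I : A ⊗ A → A ⊗ A ⊗ A`. -/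
def coLeft (Δ : A →ₗ[k] A ⊗[k] A) : A ⊗[k] A →ₗ[k] A ⊗[k] (A ⊗[k] A) :=
  (TensorProduct.assoc k A A A).toLinearMap ∘ₗ Δ.rTensor A

/-- `I ⊗ Δ : A ⊗ A → A ⊗ A ⊗ A`. -/
def coRight (Δ : A →ₗ[k] A ⊗[k] A) : A ⊗[k] A →ₗ[k] A ⊗[k] (A ⊗[k] A) :=
  Δ.lTensor A

/-- `τ ⊗ I` on `A ⊗ A ⊗ A`. -/
def flip12 : A ⊗[k] (A ⊗[k] A) →ₗ[k] A ⊗[k] (A ⊗[k] A) :=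
  (TensorProduct.leftComm k A A A).toLinearMap

/-- `I ⊗ τ` on `A ⊗ A ⊗ A`. -/
def flip23 : A ⊗[k] (A ⊗[k] A) →ₗ[k] A ⊗[k] (A ⊗[k] A) := flip2.lTensor A

@[simp] lemma flip2_tmul (x y : A) : flip2 (x ⊗ₜ[k] y) = y ⊗ₜ[k] x := rfl

@[simp] lemma flip12_tmul (x y z : A) :
    flip12 (x ⊗ₜ[k] (y ⊗ₜ[k] z)) = y ⊗ₜ[k] (x ⊗ₜ[k] z) := rfl

@[simp] lemma flip23_tmul (x y z : A) :
    flip23 (x ⊗ₜ[k] (y ⊗ₜ[k] z)) = x ⊗ₜ[k] (z ⊗ₜ[k] y) := rfl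

/-! ### Coalgebras -/

/-- Dendriform coalgebras `(A, Δ≻, Δ≺)`. -/
structure IsDendriformCoalg (Δs Δp : A →ₗ[k] A ⊗[k] A) : Prop where
  succ_prec : coLeft Δs ∘ₗ Δp = coRight Δp ∘ₗ Δs
  succ_succ : coRight Δs ∘ₗ Δs = coLeft (Δs + Δp) ∘ₗ Δs
  prec_prec : coLeft Δp ∘ₗ Δp = coRight (Δs + Δp) ∘ₗ Δp

/-- Pre-Lie coalgebras `(A, δ)`. -/
def IsPreLieCoalg (δ : A →ₗ[k] A ⊗[k] A) : Prop :=
  coRight δ ∘ₗ δ - flip12 ∘ₗ coRight δ ∘ₗ δ = coLeft δ ∘ₗ δ - flip12 ∘ₗ coLeft δ ∘ₗ δ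

/-- Noncommutative pre-Poisson coalgebras `(A, Δ≻, Δ≺, δ)`. -/
structure IsNCPrePoissonCoalg (Δs Δp δ : A →ₗ[k] A ⊗[k] A) : Prop where
  dendriform : IsDendriformCoalg Δs Δp
  preLie : IsPreLieCoalg δ
  comm_succ :
    coLeft δ ∘ₗ Δs - flip12 ∘ₗ coLeft δ ∘ₗ Δs
      = coRight Δs ∘ₗ δ - flip12 ∘ₗ coRight δ ∘ₗ Δs
  prec_comm :
    coRight δ ∘ₗ Δp - flip23 ∘ₗ coRight δ ∘ₗ Δp
      = flip12 ∘ₗ coRight Δp ∘ₗ δ - flip12 ∘ₗ coLeft δ ∘ₗ Δp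
  dot_ast :
    coLeft Δs ∘ₗ δ + coLeft Δp ∘ₗ δ = flip23 ∘ₗ coLeft δ ∘ₗ Δp + coRight δ ∘ₗ Δs

/-- Coherent noncommutative pre-Poisson coalgebras. -/
structure IsCoherentNCPrePoissonCoalg (Δs Δp δ : A →ₗ[k] A ⊗[k] A) : Prop
    extends IsNCPrePoissonCoalg Δs Δp δ where
  coherent :
    coLeft Δs ∘ₗ δ + coLeft Δp ∘ₗ δ
      = coRight Δs ∘ₗ δ + flip12 ∘ₗ flip23 ∘ₗ coRight Δp ∘ₗ δ

/-! ### Bialgebras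

In the compatibility conditions `dot = ≻ + ≺` and `Δ = Δ≻ + Δ≺`. -/

/-- The compatibility conditions between a dendriform algebra and a dendriform coalgebra. -/
structure DendriformCompat (succ prec : A →ₗ[k] A →ₗ[k] A) (Δs Δp : A →ₗ[k] A ⊗[k] A) :
    Prop where
  prec_dot : ∀ x y,
    Δp ((succ + prec) x y)
      = (succ x).lTensor A (Δp y) + ((succ + prec).flip y).rTensor A (Δp x)
  succ_dot : ∀ x y,
    Δs ((succ + prec) x y)
      = ((succ + prec) x).lTensor A (Δs y) + (prec.flip y).rTensor A (Δs x)
  dot_prec : ∀ x y,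
    (Δs + Δp) (prec x y)
      = (prec.flip y).rTensor A ((Δs + Δp) x) + (prec x).lTensor A (Δs y)
  dot_succ : ∀ x y,
    (Δs + Δp) (succ x y)
      = (succ x).lTensor A ((Δs + Δp) y) + (succ.flip y).rTensor A (Δp x)
  mixed₁ : ∀ x y,
    ((succ + prec) x).rTensor A (Δp y) - (prec.flip x).lTensor A (Δp y)
      + flip2 ((succ y).rTensor A (Δs x) - ((succ + prec).flip y).lTensor A (Δs x)) = 0
  mixed₂ : ∀ x y,
    (succ x).rTensor A ((Δs + Δp) y) - (succ.flip y).rTensor A (flip2 (Δs x))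
      + (prec y).lTensor A (flip2 (Δp x)) - (prec.flip x).lTensor A ((Δs + Δp) y) = 0

/-- Dendriform bialgebras `(A, ≻, ≺, Δ≻, Δ≺)`. -/
structure IsDendriformBialg (succ prec : A →ₗ[k] A →ₗ[k] A) (Δs Δp : A →ₗ[k] A ⊗[k] A) :
    Prop where
  alg : IsDendriform succ prec
  coalg : IsDendriformCoalg Δs Δp
  compat : DendriformCompat succ prec Δs Δp

/-- Pre-Lie bialgebras `(A, ∗, δ)`. -/
structure IsPreLieBialg (ast : A →ₗ[k] A →ₗ[k] A) (δ : A →ₗ[k] A ⊗[k] A) : Prop where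
  alg : IsPreLie ast
  coalg : IsPreLieCoalg δ
  cocycle : ∀ x y,
    δ (ast x y - ast y x)
      = ((comm ast x).lTensor A (δ y) + (ast x).rTensor A (δ y))
        - ((comm ast y).lTensor A (δ x) + (ast y).rTensor A (δ x))
  co_cocycle : ∀ x y,
    (δ - flip2 ∘ₗ δ) (ast x y)
      = (ast x).rTensor A ((δ - flip2 ∘ₗ δ) y) + (ast x).lTensor A ((δ - flip2 ∘ₗ δ) y)
        + (ast.flip y).lTensor A (δ x) - (ast.flip y).rTensor A (flip2 (δ x))

/-- Noncommutative pre-Poisson bialgebras `(A, ≻, ≺, ∗, Δ≻, Δ≺, δ)`. -/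
structure IsNCPrePoissonBialg (succ prec ast : A →ₗ[k] A →ₗ[k] A)
    (Δs Δp δ : A →ₗ[k] A ⊗[k] A) : Prop where
  alg : IsCoherentNCPrePoisson succ prec ast
  coalg : IsCoherentNCPrePoissonCoalg Δs Δp δ
  dendriform : IsDendriformBialg succ prec Δs Δp
  preLie : IsPreLieBialg ast δ
  compat₁ : ∀ x y,
    (Δs + Δp) (ast x y)
      = (ast x).rTensor A ((Δs + Δp) y) + (ast x).lTensor A ((Δs + Δp) y)
        - (prec y).lTensor A (δ x) - (succ.flip y).rTensor A (flip2 (δ x))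
  compat₂ : ∀ x y,
    (δ - flip2 ∘ₗ δ) (prec y x)
      = (prec.flip x).lTensor A ((δ - flip2 ∘ₗ δ) y) + (ast.flip y).rTensor A (flip2 (Δs x))
        + (prec y).lTensor A (δ x) - (ast x).rTensor A ((Δs + Δp) y)
  compat₃ : ∀ x y,
    δ ((succ + prec) x y)
      = ((succ + prec).flip y).lTensor A (δ x) + ((succ + prec) x).lTensor A (δ y)
        - (ast x).rTensor A (flip2 (Δp y)) - (ast y).rTensor A (Δs x)
  compat₄ : ∀ x y,
    Δp (ast x y - ast y x)
      = (comm ast x).rTensor A (Δp y) + (succ y).lTensor A (flip2 (δ x))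
        + (ast x).lTensor A (Δp y) - ((succ + prec).flip y).rTensor A (flip2 (δ x))

/-! ### The Yang-Baxter equation

For a product `m`, the maps below send `(r, s)` with `r = ∑ aᵢ ⊗ bᵢ`, `s = ∑ cⱼ ⊗ dⱼ` to
`r₁₂ m s₁₃`, `r₁₃ m s₂₃`, `r₁₂ m s₂₃`, `r₂₃ m s₁₂`; the lemmas give their values on pure
tensors. -/

/-- `r₁₂ m s₁₃ = ∑ m(aᵢ, cⱼ) ⊗ bᵢ ⊗ dⱼ`. -/
def ybe12_13 (m : A →ₗ[k] A →ₗ[k] A) :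
    A ⊗[k] A →ₗ[k] A ⊗[k] A →ₗ[k] A ⊗[k] (A ⊗[k] A) :=
  (TensorProduct.mk k (A ⊗[k] A) (A ⊗[k] A)).compr₂
    ((TensorProduct.lift m).rTensor (A ⊗[k] A) ∘ₗ
      (TensorProduct.tensorTensorTensorComm k A A A A).toLinearMap)

/-- `r₁₃ m s₂₃ = ∑ aᵢ ⊗ cⱼ ⊗ m(bᵢ, dⱼ)`. -/
def ybe13_23 (m : A →ₗ[k] A →ₗ[k] A) :
    A ⊗[k] A →ₗ[k] A ⊗[k] A →ₗ[k] A ⊗[k] (A ⊗[k] A) :=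
  (TensorProduct.mk k (A ⊗[k] A) (A ⊗[k] A)).compr₂
    ((TensorProduct.assoc k A A A).toLinearMap ∘ₗ
      (TensorProduct.lift m).lTensor (A ⊗[k] A) ∘ₗ
      (TensorProduct.tensorTensorTensorComm k A A A A).toLinearMap)

/-- `r₁₂ m s₂₃ = ∑ aᵢ ⊗ m(bᵢ, cⱼ) ⊗ dⱼ`. -/
def ybe12_23 (m : A →ₗ[k] A →ₗ[k] A) :
    A ⊗[k] A →ₗ[k] A ⊗[k] A →ₗ[k] A ⊗[k] (A ⊗[k] A) :=
  (TensorProduct.mk k (A ⊗[k] A) (A ⊗[k] A)).compr₂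
    (((TensorProduct.lift m).rTensor A ∘ₗ
        (TensorProduct.assoc k A A A).symm.toLinearMap).lTensor A ∘ₗ
      (TensorProduct.assoc k A A (A ⊗[k] A)).toLinearMap)

/-- `r₂₃ m s₁₂ = ∑ cⱼ ⊗ m(aᵢ, dⱼ) ⊗ bᵢ`. -/
def ybe23_12 (m : A →ₗ[k] A →ₗ[k] A) :
    A ⊗[k] A →ₗ[k] A ⊗[k] A →ₗ[k] A ⊗[k] (A ⊗[k] A) :=
  (ybe12_23 m.flip).flip

@[simp] lemma ybe12_13_tmul (m : A →ₗ[k] A →ₗ[k] A) (a b c d : A) :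
    ybe12_13 m (a ⊗ₜ[k] b) (c ⊗ₜ[k] d) = m a c ⊗ₜ[k] (b ⊗ₜ[k] d) := rfl

@[simp] lemma ybe13_23_tmul (m : A →ₗ[k] A →ₗ[k] A) (a b c d : A) :
    ybe13_23 m (a ⊗ₜ[k] b) (c ⊗ₜ[k] d) = a ⊗ₜ[k] (c ⊗ₜ[k] m b d) := rfl

@[simp] lemma ybe12_23_tmul (m : A →ₗ[k] A →ₗ[k] A) (a b c d : A) :
    ybe12_23 m (a ⊗ₜ[k] b) (c ⊗ₜ[k] d) = a ⊗ₜ[k] (m b c ⊗ₜ[k] d) := rfl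

@[simp] lemma ybe23_12_tmul (m : A →ₗ[k] A →ₗ[k] A) (a b c d : A) :
    ybe23_12 m (a ⊗ₜ[k] b) (c ⊗ₜ[k] d) = c ⊗ₜ[k] (m a d ⊗ₜ[k] b) := rfl

/-- `D(r) = r₁₂ · r₁₃ - r₂₃ ≻ r₁₂ - r₁₃ ≺ r₂₃`. -/
def dEq (succ prec : A →ₗ[k] A →ₗ[k] A) (r : A ⊗[k] A) : A ⊗[k] (A ⊗[k] A) :=
  ybe12_13 (succ + prec) r r - ybe23_12 succ r r - ybe13_23 prec r r

/-- `S(r) = r₁₂ ∗ r₂₃ - r₁₂ ∗ r₁₃ + [r₁₃, r₂₃]`. -/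
def sEq (ast : A →ₗ[k] A →ₗ[k] A) (r : A ⊗[k] A) : A ⊗[k] (A ⊗[k] A) :=
  ybe12_23 ast r r - ybe12_13 ast r r + ybe13_23 (comm ast) r r

/-- The noncommutative pre-Poisson Yang-Baxter equation. -/
def IsNPPYBESolution (succ prec ast : A →ₗ[k] A →ₗ[k] A) (r : A ⊗[k] A) : Prop :=
  dEq succ prec r = 0 ∧ sEq ast r = 0

/-- Invariant elements of `A ⊗ A`. -/
structure IsInvariant (succ prec ast : A →ₗ[k] A →ₗ[k] A) (r : A ⊗[k] A) : Prop where
  succ_inv : ∀ x,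
    ((succ + prec) x).lTensor A (flip2 r) - (prec.flip x).rTensor A (flip2 r) = 0
  prec_inv : ∀ x,
    ((succ + prec).flip x).rTensor A r - (succ x).lTensor A r = 0
  ast_inv : ∀ x,
    (ast x).rTensor A r + (comm ast x).lTensor A r = 0

/-! ### The comultiplications defined by `r` -/

/-- `Δ≻,r(x) = (I ⊗ L_·(x) - R_≺(x) ⊗ I) τ(r)`. -/
def coSucc (succ prec : A →ₗ[k] A →ₗ[k] A) (r : A ⊗[k] A) : A →ₗ[k] A ⊗[k] A :=
  (LinearMap.lTensorHom A ∘ₗ (succ + prec) - LinearMap.rTensorHom A ∘ₗ prec.flip).flip (flip2 r)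

/-- `Δ≺,r(x) = (R_·(x) ⊗ I - I ⊗ L_≻(x)) r`. -/
def coPrec (succ prec : A →ₗ[k] A →ₗ[k] A) (r : A ⊗[k] A) : A →ₗ[k] A ⊗[k] A :=
  (LinearMap.rTensorHom A ∘ₗ (succ + prec).flip - LinearMap.lTensorHom A ∘ₗ succ).flip r

/-- `δ_r(x) = (L_∗(x) ⊗ I + I ⊗ ad(x)) r`. -/
def coAst (ast : A →ₗ[k] A →ₗ[k] A) (r : A ⊗[k] A) : A →ₗ[k] A ⊗[k] A :=
  (LinearMap.rTensorHom A ∘ₗ ast + LinearMap.lTensorHom A ∘ₗ comm ast).flip r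

lemma coSucc_apply (succ prec : A →ₗ[k] A →ₗ[k] A) (r : A ⊗[k] A) (x : A) :
    coSucc succ prec r x
      = ((succ + prec) x).lTensor A (flip2 r) - (prec.flip x).rTensor A (flip2 r) := rfl

lemma coPrec_apply (succ prec : A →ₗ[k] A →ₗ[k] A) (r : A ⊗[k] A) (x : A) :
    coPrec succ prec r x
      = ((succ + prec).flip x).rTensor A r - (succ x).lTensor A r := rfl

lemma coAst_apply (ast : A →ₗ[k] A →ₗ[k] A) (r : A ⊗[k] A) (x : A) :
    coAst ast r x = (ast x).rTensor A r + (comm ast x).lTensor A r := rfl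

end PrePoisson

end

/-! Write `s = r - flip2 r`, and let `D` and `S` be the two expressions in the Yang-Baxter equation.
Invariance of `s` says exactly that the three coproducts built from `s` vanish. Every bialgebra
axiom is then an equation `F = 0` in which `F` is linear in `r` (compatibility conditions) or
quadratic in `r` (coalgebra axioms).

The method is to find correction terms that vanish at `r` and turn `F` into a formal consequence of
the algebra axioms, valid for arbitrary tensors. The corrections are of two kinds. The first are leg
permutations of `D` or `S`, acted on by multiplications by `x` in one leg; these occur only in the
quadratic axioms. The second are expressions containing a coproduct of `t - flip2 t`, which exchange
`r` for its flip where needed.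

For the corrected `F` it is enough to consider pure tensors. In the quadratic case the terms of the
double sum cancel only after exchanging the two summation indices, so the identity to check is the
symmetrized one, together with its diagonal (`biadditive_self_eq_zero`). Each check reduces words of
length three in `A` to a common form by `IsCoherentNCPrePoisson.rewriting` and
`IsCoherentNCPrePoisson.left_comm`, and compares coefficients. -/

open scoped TensorProduct
open TensorProduct (assoc_tmul)
open LinearMap (lTensor_tmul rTensor_tmul)

noncomputable section

namespace PrePoisson

variable {k A : Type*} [Field k] [AddCommGroup A] [Module k A]

/-! ### Algebra axioms as rewriting rules, and invariance -/

section Algebra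

variable {succ prec ast : A →ₗ[k] A →ₗ[k] A}

lemma IsDendriform.prec_prec_left (h : IsDendriform succ prec) (x y z : A) :
    prec (prec x y) z = prec x (succ y z) + prec x (prec y z) := by
  rw [h.prec_prec, map_add]

lemma IsDendriform.succ_succ_left (h : IsDendriform succ prec) (x y z : A) :
    succ (succ x y) z = succ x (succ y z) - succ (prec x y) z := by
  rw [h.succ_succ, map_add, LinearMap.add_apply, add_sub_cancel_right]

lemma IsNCPrePoisson.ast_succ_left (h : IsNCPrePoisson succ prec ast) (x y z : A) :
    ast (succ x y) z = prec (ast x z) y + succ x (ast y z) - ast (prec x y) z := by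
  rw [← h.dot_ast, map_add, LinearMap.add_apply, add_sub_cancel_right]

lemma IsNCPrePoisson.ast_succ_right (h : IsNCPrePoisson succ prec ast) (x y z : A) :
    ast x (succ y z) = succ y (ast x z) + succ (ast x y) z - succ (ast y x) z := by
  have := h.comm_succ x y z
  rw [map_sub, LinearMap.sub_apply] at this
  rw [add_sub_assoc, this, add_sub_cancel]

lemma IsNCPrePoisson.ast_prec_right (h : IsNCPrePoisson succ prec ast) (x y z : A) :
    ast x (prec y z) = prec (ast x y) z + prec y (ast x z) - prec y (ast z x) := by
  have := h.prec_comm y x z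
  rw [map_sub] at this
  rw [add_sub_assoc, this, add_sub_cancel]

lemma IsPreLie.ast_left_comm (h : IsPreLie ast) (x y z : A) :
    ast x (ast y z) = ast y (ast x z) + ast (ast x y) z - ast (ast y x) z := by
  linear_combination (norm := abel) -h x y z

/-- Coherence enters here: `dot_ast` and `coherent` expand the same element in two ways. Comparing
them and removing the products `ast x (succ y z)` and `ast y (prec z x)` leaves a relation that
exchanges `x` and `y`. -/
lemma IsCoherentNCPrePoisson.succ_ast_left_comm (h : IsCoherentNCPrePoisson succ prec ast)
    (x y z : A) :
    succ x (ast y z) = succ y (ast x z) + prec (ast y z) x - prec (ast x z) y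
      + succ (ast x y) z - succ (ast y x) z + prec z (ast y x) - prec z (ast x y) := by
  have h₁ := h.coherent x y z
  rw [h.dot_ast, h.ast_succ_right, h.ast_prec_right] at h₁
  linear_combination (norm := abel) h₁

/-- All axioms that can be oriented uniformly, as rewriting rules for words of length three. -/
lemma IsCoherentNCPrePoisson.rewriting (h : IsCoherentNCPrePoisson succ prec ast) :
    (∀ x y z, prec (prec x y) z = prec x (succ y z) + prec x (prec y z)) ∧
    (∀ x y z, prec (succ x y) z = succ x (prec y z)) ∧
    (∀ x y z, succ (succ x y) z = succ x (succ y z) - succ (prec x y) z) ∧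
    (∀ x y z, ast (succ x y) z = prec (ast x z) y + succ x (ast y z) - ast (prec x y) z) ∧
    (∀ x y z, ast x (succ y z) = succ y (ast x z) + succ (ast x y) z - succ (ast y x) z) ∧
    (∀ x y z, ast x (prec y z) = prec (ast x y) z + prec y (ast x z) - prec y (ast z x)) :=
  ⟨h.dendriform.prec_prec_left, h.dendriform.succ_prec, h.dendriform.succ_succ_left,
    h.ast_succ_left, h.ast_succ_right, h.ast_prec_right⟩

/-- The axioms symmetric in `x` and `y`, to be oriented by the choice of `x` and `y`. -/
lemma IsCoherentNCPrePoisson.left_comm (h : IsCoherentNCPrePoisson succ prec ast) (x y : A) :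
    (∀ z, ast x (ast y z) = ast y (ast x z) + ast (ast x y) z - ast (ast y x) z) ∧
    (∀ z, succ x (ast y z) = succ y (ast x z) + prec (ast y z) x - prec (ast x z) y
      + succ (ast x y) z - succ (ast y x) z + prec z (ast y x) - prec z (ast x y)) :=
  ⟨h.preLie.ast_left_comm x y, h.succ_ast_left_comm x y⟩

end Algebra

lemma IsInvariant.coproducts_eq_zero {succ prec ast : A →ₗ[k] A →ₗ[k] A} {s : A ⊗[k] A}
    (h : IsInvariant succ prec ast s) :
    coSucc succ prec s = 0 ∧ coPrec succ prec s = 0 ∧ coAst ast s = 0 :=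
  ⟨LinearMap.ext h.succ_inv, LinearMap.ext h.prec_inv, LinearMap.ext h.ast_inv⟩

/-! ### Reduction of linear and quadratic identities to pure tensors -/

section Additive

lemma additive_eq_zero {M : Type*} [AddCommGroup M] (f : A ⊗[k] A → M)
    (add : ∀ t u, f (t + u) = f t + f u) (pure : ∀ a b : A, f (a ⊗ₜ b) = 0)
    (r : A ⊗[k] A) : f r = 0 := by
  induction r using TensorProduct.induction_on with
  | zero =>
    have := add 0 0
    rwa [add_zero, left_eq_add] at this
  | add t u ht hu => rw [add, ht, hu, add_zero]
  | tmul a b => exact pure a b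

/-- Expanding `f r r` over a sum of pure tensors gives diagonal terms and pairs of cross terms. The
diagonal condition is separate because in characteristic two it does not follow from the symmetrized
one. Additivity suffices, so `f` need not be bundled as a bilinear map. -/
lemma biadditive_self_eq_zero {M : Type*} [AddCommGroup M] (f : A ⊗[k] A → A ⊗[k] A → M)
    (add : ∀ t u v, f (t + u) v = f t v + f u v ∧ f v (t + u) = f v t + f v u)
    (pure : ∀ a b c d : A, f (a ⊗ₜ b) (a ⊗ₜ b) = 0 ∧
      f (a ⊗ₜ b) (c ⊗ₜ d) + f (c ⊗ₜ d) (a ⊗ₜ b) = 0)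
    (r : A ⊗[k] A) : f r r = 0 := by
  have add_left : ∀ t u v, f (t + u) v = f t v + f u v := fun t u v => (add t u v).1
  have add_right : ∀ v t u, f v (t + u) = f v t + f v u := fun v t u => (add t u v).2
  have zero_left : ∀ u, f 0 u = 0 := fun u => by
    have := add_left 0 0 u
    rwa [add_zero, left_eq_add] at this
  have zero_right : ∀ t, f t 0 = 0 := fun t => by
    have := add_right t 0 0
    rwa [add_zero, left_eq_add] at this
  have swap : ∀ t u, f t u + f u t = 0 := by
    intro t u
    induction t using TensorProduct.induction_on with
    | zero => rw [zero_left, zero_right, add_zero]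
    | add t t' ht ht' => rw [add_left, add_right, add_add_add_comm, ht, ht', add_zero]
    | tmul a b =>
      induction u using TensorProduct.induction_on with
      | zero => rw [zero_left, zero_right, add_zero]
      | add u u' hu hu' => rw [add_left, add_right, add_add_add_comm, hu, hu', add_zero]
      | tmul c d => exact (pure a b c d).2
  induction r using TensorProduct.induction_on with
  | zero => exact zero_left 0
  | add t u ht hu =>
    rw [add_left, add_right, add_right, ht, hu, zero_add, add_zero, swap]
  | tmul a b => exact (pure a b 0 0).1

end Additive

/-! ### Expansion of tensors and coproducts -/

section Expansion

variable {M N : Type*} [AddCommGroup M] [Module k M] [AddCommGroup N] [Module k N]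

lemma tmul_distrib :
    (∀ (x y : M) (z : N), (x + y) ⊗ₜ[k] z = x ⊗ₜ z + y ⊗ₜ z) ∧
    (∀ (x y : M) (z : N), (x - y) ⊗ₜ[k] z = x ⊗ₜ z - y ⊗ₜ z) ∧
    (∀ (x : M) (y z : N), x ⊗ₜ[k] (y + z) = x ⊗ₜ y + x ⊗ₜ z) ∧
    (∀ (x : M) (y z : N), x ⊗ₜ[k] (y - z) = x ⊗ₜ y - x ⊗ₜ z) :=
  ⟨TensorProduct.add_tmul, fun _ _ _ => TensorProduct.sub_tmul .., TensorProduct.tmul_add,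
    fun _ _ _ => TensorProduct.tmul_sub ..⟩

lemma linearMap_apply :
    (∀ (f g : M →ₗ[k] N) (x : M), (f + g) x = f x + g x) ∧
    (∀ (f g : M →ₗ[k] N) (x : M), (f - g) x = f x - g x) :=
  ⟨fun _ _ _ => rfl, fun _ _ _ => rfl⟩

end Expansion

section PureTensors

lemma coproducts_add :
    (∀ (succ prec : A →ₗ[k] A →ₗ[k] A) (r s : A ⊗[k] A),
      coSucc succ prec (r + s) = coSucc succ prec r + coSucc succ prec s) ∧
    (∀ (succ prec : A →ₗ[k] A →ₗ[k] A) (r s : A ⊗[k] A),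
      coPrec succ prec (r + s) = coPrec succ prec r + coPrec succ prec s) ∧
    (∀ (ast : A →ₗ[k] A →ₗ[k] A) (r s : A ⊗[k] A),
      coAst ast (r + s) = coAst ast r + coAst ast s) :=
  ⟨fun _ _ _ _ => by simp only [coSucc, map_add],
    fun _ _ _ _ => map_add .., fun _ _ _ => map_add ..⟩

lemma coproducts_sub :
    (∀ (succ prec : A →ₗ[k] A →ₗ[k] A) (r s : A ⊗[k] A),
      coSucc succ prec (r - s) = coSucc succ prec r - coSucc succ prec s) ∧
    (∀ (succ prec : A →ₗ[k] A →ₗ[k] A) (r s : A ⊗[k] A),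
      coPrec succ prec (r - s) = coPrec succ prec r - coPrec succ prec s) ∧
    (∀ (ast : A →ₗ[k] A →ₗ[k] A) (r s : A ⊗[k] A),
      coAst ast (r - s) = coAst ast r - coAst ast s) :=
  ⟨fun _ _ _ _ => by simp only [coSucc, map_sub],
    fun _ _ _ _ => map_sub .., fun _ _ _ => map_sub ..⟩

lemma coproducts_tmul :
    (∀ (succ prec : A →ₗ[k] A →ₗ[k] A) (a b x : A), coSucc succ prec (a ⊗ₜ[k] b) x
      = b ⊗ₜ succ x a + b ⊗ₜ prec x a - prec b x ⊗ₜ a) ∧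
    (∀ (succ prec : A →ₗ[k] A →ₗ[k] A) (a b x : A), coPrec succ prec (a ⊗ₜ[k] b) x
      = succ a x ⊗ₜ b + prec a x ⊗ₜ b - a ⊗ₜ succ x b) ∧
    (∀ (ast : A →ₗ[k] A →ₗ[k] A) (a b x : A), coAst ast (a ⊗ₜ[k] b) x
      = ast x a ⊗ₜ b + a ⊗ₜ ast x b - a ⊗ₜ ast b x) := by
  refine ⟨fun _ _ a b x => ?_, fun _ _ a b x => ?_, fun _ a b x => ?_⟩
  · simp [coSucc_apply]
  · simp [coPrec_apply, TensorProduct.add_tmul]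
  · simp [coAst_apply, TensorProduct.tmul_sub, add_sub_assoc]

end PureTensors

/-! ### Operators for the correction terms, and the polarized Yang-Baxter expressions -/

section Quadratic

/-- `z ↦ (m z ⊗ I) u`. -/
def actLeft (m : A →ₗ[k] A →ₗ[k] A) (u : A ⊗[k] A) : A →ₗ[k] A ⊗[k] A :=
  (LinearMap.rTensorHom A ∘ₗ m).flip u

/-- `z ↦ (I ⊗ m z) u`. -/
def actRight (m : A →ₗ[k] A →ₗ[k] A) (u : A ⊗[k] A) : A →ₗ[k] A ⊗[k] A :=
  (LinearMap.lTensorHom A ∘ₗ m).flip u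

/-- The polarization of `dEq`. -/
def dForm (succ prec : A →ₗ[k] A →ₗ[k] A) :
    A ⊗[k] A →ₗ[k] A ⊗[k] A →ₗ[k] A ⊗[k] (A ⊗[k] A) :=
  ybe12_13 (succ + prec) - ybe23_12 succ - ybe13_23 prec

/-- The polarization of `sEq`. -/
def sForm (ast : A →ₗ[k] A →ₗ[k] A) :
    A ⊗[k] A →ₗ[k] A ⊗[k] A →ₗ[k] A ⊗[k] (A ⊗[k] A) :=
  ybe12_23 ast - ybe12_13 ast + ybe13_23 (comm ast)

lemma operators_add :
    (∀ (m : A →ₗ[k] A →ₗ[k] A) (u v : A ⊗[k] A),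
      actLeft m (u + v) = actLeft m u + actLeft m v) ∧
    (∀ (m : A →ₗ[k] A →ₗ[k] A) (u v : A ⊗[k] A),
      actRight m (u + v) = actRight m u + actRight m v) ∧
    (∀ Δ Δ' : A →ₗ[k] A ⊗[k] A, coLeft (Δ + Δ') = coLeft Δ + coLeft Δ') ∧
    (∀ Δ Δ' : A →ₗ[k] A ⊗[k] A, coRight (Δ + Δ') = coRight Δ + coRight Δ') :=
  ⟨fun _ _ _ => map_add .., fun _ _ _ => map_add ..,
    fun _ _ => by simp only [coLeft, LinearMap.rTensor_add, LinearMap.comp_add],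
    fun _ _ => by simp only [coRight, LinearMap.lTensor_add]⟩

lemma operators_zero :
    (∀ m : A →ₗ[k] A →ₗ[k] A, actLeft m 0 = 0) ∧
    (∀ m : A →ₗ[k] A →ₗ[k] A, actRight m 0 = 0) ∧
    coLeft (0 : A →ₗ[k] A ⊗[k] A) = 0 ∧ coRight (0 : A →ₗ[k] A ⊗[k] A) = 0 := by
  refine ⟨fun _ => map_zero _, fun _ => map_zero _, ?_, ?_⟩
  · simp only [coLeft, LinearMap.rTensor_zero, LinearMap.comp_zero]
  · simp only [coRight, LinearMap.lTensor_zero]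

lemma operators_apply :
    (∀ (m : A →ₗ[k] A →ₗ[k] A) u z, actLeft m u z = (m z).rTensor A u) ∧
    (∀ (m : A →ₗ[k] A →ₗ[k] A) u z, actRight m u z = (m z).lTensor A u) ∧
    (∀ (Δ : A →ₗ[k] A ⊗[k] A) a b,
      coLeft Δ (a ⊗ₜ b) = TensorProduct.assoc k A A A (Δ a ⊗ₜ b)) ∧
    (∀ (Δ : A →ₗ[k] A ⊗[k] A) a b, coRight Δ (a ⊗ₜ b) = a ⊗ₜ Δ b) :=
  ⟨fun _ _ _ => rfl, fun _ _ _ => rfl, fun _ _ _ => rfl, fun _ _ _ => rfl⟩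

lemma IsNPPYBESolution.forms_self {succ prec ast : A →ₗ[k] A →ₗ[k] A} {r : A ⊗[k] A}
    (h : IsNPPYBESolution succ prec ast r) :
    dForm succ prec r r = 0 ∧ sForm ast r r = 0 := h

lemma dForm_tmul (succ prec : A →ₗ[k] A →ₗ[k] A) (a b c d : A) :
    dForm succ prec (a ⊗ₜ[k] b) (c ⊗ₜ[k] d)
      = succ a c ⊗ₜ[k] (b ⊗ₜ[k] d) + prec a c ⊗ₜ[k] (b ⊗ₜ[k] d) - c ⊗ₜ[k] (succ a d ⊗ₜ[k] b)
        - a ⊗ₜ[k] (c ⊗ₜ[k] prec b d) := by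
  simp [dForm, TensorProduct.add_tmul]

lemma sForm_tmul (ast : A →ₗ[k] A →ₗ[k] A) (a b c d : A) :
    sForm ast (a ⊗ₜ[k] b) (c ⊗ₜ[k] d)
      = a ⊗ₜ[k] (ast b c ⊗ₜ[k] d) - ast a c ⊗ₜ[k] (b ⊗ₜ[k] d)
        + a ⊗ₜ[k] (c ⊗ₜ[k] ast b d) - a ⊗ₜ[k] (c ⊗ₜ[k] ast d b) := by
  simp [sForm, TensorProduct.tmul_sub, add_sub_assoc]

end Quadratic

/-! ### Coalgebra axioms, quadratic in `r` -/

section Coalgebra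

variable {succ prec ast : A →ₗ[k] A →ₗ[k] A} {r : A ⊗[k] A}

local notation "Δs" => coSucc succ prec
local notation "Δp" => coPrec succ prec
local notation "δ" => coAst ast

lemma IsCoherentNCPrePoisson.isDendriformCoalg (h : IsCoherentNCPrePoisson succ prec ast)
    (hr : IsNPPYBESolution succ prec ast r)
    (hs : IsInvariant succ prec ast (r - flip2 r)) :
    IsDendriformCoalg (Δs r) (Δp r) where
  succ_prec := by
    refine LinearMap.ext fun x => ?_
    -- The `dForm` terms are `I ⊗ I ⊗ L_≻(x) - R_≺(x) ⊗ I ⊗ I` applied to a cyclic permutation of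
    -- `D`. In the remaining correction a leg of `t'` multiplies a leg of the coproduct of `t -
    -- flip2 t`.
    have key := biadditive_self_eq_zero (fun t t' : A ⊗[k] A =>
        coLeft (Δs t) (Δp t' x)
          - (coRight (Δp t) (Δs t' x))
          + flip12 (coRight (actLeft prec (Δp (t - flip2 t) x)) t')
          + ((succ x).lTensor A).lTensor A (flip12 (flip23 (dForm succ prec t t')))
          - (prec.flip x).rTensor _ (flip12 (flip23 (dForm succ prec t t')))) ?_ ?_ r
    · simp only [hr.forms_self, hs.coproducts_eq_zero, LinearMap.zero_apply, map_zero,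
        operators_zero, sub_zero, add_zero] at key
      exact sub_eq_zero.mp key
    · intro t u v
      -- `add_sub_add_comm` regroups `(t + u) - (flip2 t + flip2 u)`, so that the coproducts split
      -- along the two antisymmetric parts.
      refine ⟨?_, ?_⟩ <;> simp only [add_sub_add_comm, map_add, coproducts_add, operators_add,
        LinearMap.add_apply] <;> abel
    · intro a b c d
      refine ⟨?_, ?_⟩ <;> simp only [map_add, map_sub, flip2_tmul, flip12_tmul, flip23_tmul,
        coproducts_tmul, coproducts_sub, operators_apply, dForm_tmul, assoc_tmul, linearMap_apply,
        LinearMap.flip_apply, rTensor_tmul, lTensor_tmul, tmul_distrib, h.rewriting] <;> abel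
  succ_succ := by
    refine LinearMap.ext fun x => ?_
    have key := biadditive_self_eq_zero (fun t t' : A ⊗[k] A =>
        coRight (Δs t) (Δs t' x)
          - (coLeft (Δs t + Δp t) (Δs t' x))
          + flip23 (flip12 (coRight (actRight prec (Δs (t - flip2 t) x)) t'))
          - (((succ + prec) x).lTensor A).lTensor A (flip23 (flip12 (dForm succ prec t t')))
          + (prec.flip x).rTensor _ (flip23 (flip12 (dForm succ prec t t')))
          + coLeft (Δs (t - flip2 t)) (Δs t' x)) ?_ ?_ r
    · simp only [hr.forms_self, hs.coproducts_eq_zero, LinearMap.zero_apply, map_zero,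
        operators_zero, sub_zero, add_zero] at key
      exact sub_eq_zero.mp key
    · intro t u v
      refine ⟨?_, ?_⟩ <;> simp only [add_sub_add_comm, map_add, coproducts_add, operators_add,
        LinearMap.add_apply] <;> abel
    · intro a b c d
      refine ⟨?_, ?_⟩ <;> simp only [map_add, map_sub, flip2_tmul, flip12_tmul, flip23_tmul,
        coproducts_sub, coproducts_tmul, operators_apply, dForm_tmul, assoc_tmul, linearMap_apply,
        LinearMap.flip_apply, rTensor_tmul, lTensor_tmul, tmul_distrib, h.rewriting] <;> abel
  prec_prec := by
    refine LinearMap.ext fun x => ?_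
    have key := biadditive_self_eq_zero (fun t t' : A ⊗[k] A =>
        coLeft (Δp t) (Δp t' x)
          - (coRight (Δs t + Δp t) (Δp t' x))
          + ((succ x).lTensor A).lTensor A (dForm succ prec t t')
          - ((succ + prec).flip x).rTensor _ (dForm succ prec t t')
          + coRight (Δs (t - flip2 t)) (Δp t' x)) ?_ ?_ r
    · simp only [hr.forms_self, hs.coproducts_eq_zero, LinearMap.zero_apply, map_zero,
        operators_zero, sub_zero, add_zero] at key
      exact sub_eq_zero.mp key
    · intro t u v
      refine ⟨?_, ?_⟩ <;> simp only [add_sub_add_comm, map_add, coproducts_add, operators_add,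
        LinearMap.add_apply] <;> abel
    · intro a b c d
      refine ⟨?_, ?_⟩ <;> simp only [map_add, map_sub, flip2_tmul, coproducts_sub, coproducts_tmul,
        operators_apply, dForm_tmul, assoc_tmul, linearMap_apply, LinearMap.flip_apply,
        rTensor_tmul, lTensor_tmul, tmul_distrib, h.rewriting] <;> abel

/-- Up to invariance terms, the defect is `L_∗(x) ⊗ I ⊗ I + I ⊗ L_∗(x) ⊗ I + I ⊗ I ⊗ ad(x)` applied
to `S(r)`. Only the pre-Lie identity of the algebra is needed. -/
lemma IsCoherentNCPrePoisson.isPreLieCoalg_coAst (h : IsCoherentNCPrePoisson succ prec ast)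
    (hr : IsNPPYBESolution succ prec ast r)
    (hs : IsInvariant succ prec ast (r - flip2 r)) :
    IsPreLieCoalg (δ r) := by
  refine LinearMap.ext fun x => ?_
  have key := biadditive_self_eq_zero (fun t t' : A ⊗[k] A =>
      coRight (δ t) (δ t' x) - flip12 (coRight (δ t) (δ t' x))
        - (coLeft (δ t) (δ t' x) - flip12 (coLeft (δ t) (δ t' x)))
        - (ast x).rTensor _ (sForm ast t t')
        - ((ast x).rTensor A).lTensor A (sForm ast t t')
        - ((comm ast x).lTensor A).lTensor A (sForm ast t t')
        + flip12 (coLeft (actRight ast.flip (δ (t - flip2 t) x)) t')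
        - flip12 (coLeft (δ (t - flip2 t)) (δ t' x))) ?_ ?_ r
  · simp only [hr.forms_self, hs.coproducts_eq_zero, LinearMap.zero_apply, map_zero, operators_zero,
      sub_zero, add_zero] at key
    exact sub_eq_zero.mp key
  · intro t u v
    refine ⟨?_, ?_⟩ <;> simp only [add_sub_add_comm, map_add, coproducts_add, operators_add,
      LinearMap.add_apply] <;> abel
  · intro a b c d
    -- The left-commutation rule would loop if stated for all pairs. Each relevant pair is given one
    -- orientation, here with `x` moved outward.
    refine ⟨?_, ?_⟩ <;> simp only [map_add, map_sub, flip2_tmul, flip12_tmul, coproducts_sub,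
      coproducts_tmul, operators_apply, sForm_tmul, assoc_tmul, comm_apply, linearMap_apply,
      LinearMap.flip_apply, rTensor_tmul, lTensor_tmul, tmul_distrib, h.left_comm a x,
      h.left_comm b x, h.left_comm c x, h.left_comm d x, h.left_comm b d] <;> abel

/-- Both equations contribute: `L_∗(x)` acts on the first leg of a permuted `D`, and `I ⊗ I ⊗ L_·(x)
- I ⊗ R_≺(x) ⊗ I` acts on `S`. -/
lemma IsCoherentNCPrePoisson.coLeft_coAst_coSucc (h : IsCoherentNCPrePoisson succ prec ast)
    (hr : IsNPPYBESolution succ prec ast r)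
    (hs : IsInvariant succ prec ast (r - flip2 r)) :
    coLeft (δ r) ∘ₗ Δs r - flip12 ∘ₗ coLeft
      (δ r) ∘ₗ Δs r
      = coRight (Δs r) ∘ₗ δ r - flip12 ∘ₗ coRight
        (δ r) ∘ₗ Δs r := by
  refine LinearMap.ext fun x => ?_
  have key := biadditive_self_eq_zero (fun t t' : A ⊗[k] A =>
      coLeft (δ t) (Δs t' x) - flip12
        (coLeft (δ t) (Δs t' x))
        -
          (coRight (Δs t) (δ t' x) - flip12
            (coRight (δ t) (Δs t' x)))
        - flip23 (coLeft (actLeft ast (Δs (t - flip2 t) x)) t')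
        + (ast x).rTensor _ (flip23 (flip12 (dForm succ prec t t')))
        - flip23 (flip12 (coLeft ((ast x).lTensor A ∘ₗ Δp (t - flip2 t)) t'))
        - coRight (((succ + prec) x).lTensor A ∘ₗ δ (t - flip2 t)) t'
        + coRight ((prec.flip x).rTensor A ∘ₗ δ (t - flip2 t)) t'
        + (((succ + prec) x).lTensor A).lTensor A (sForm ast t t')
        - ((prec.flip x).rTensor A).lTensor A (sForm ast t t')
        + flip12 (coLeft (δ (t - flip2 t)) (Δs t' x))) ?_ ?_ r
  · simp only [hr.forms_self, hs.coproducts_eq_zero, LinearMap.zero_apply, LinearMap.comp_zero,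
      map_zero, operators_zero, sub_zero, add_zero] at key
    exact sub_eq_zero.mp key
  · intro t u v
    refine ⟨?_, ?_⟩ <;> simp only [add_sub_add_comm, map_add, coproducts_add, operators_add,
      LinearMap.add_apply, LinearMap.comp_add] <;> abel
  · intro a b c d
    refine ⟨?_, ?_⟩ <;> simp only [map_add, map_sub, flip2_tmul, flip12_tmul, flip23_tmul,
      coproducts_sub, coproducts_tmul, operators_apply, dForm_tmul, sForm_tmul, assoc_tmul,
      LinearMap.comp_apply, linearMap_apply, LinearMap.flip_apply, rTensor_tmul, lTensor_tmul,
      tmul_distrib, h.rewriting, h.left_comm a x, h.left_comm c x] <;> abel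

set_option maxHeartbeats 400000 in
-- The left side is antisymmetrized in the last two legs, so `S` enters through `S - (I ⊗ τ) S`,
-- while `D` enters with its last two legs exchanged.
lemma IsCoherentNCPrePoisson.coRight_coAst_coPrec (h : IsCoherentNCPrePoisson succ prec ast)
    (hr : IsNPPYBESolution succ prec ast r)
    (hs : IsInvariant succ prec ast (r - flip2 r)) :
    coRight (δ r) ∘ₗ Δp r - flip23 ∘ₗ coRight
      (δ r) ∘ₗ Δp r
      = flip12 ∘ₗ coRight (Δp r) ∘ₗ δ r - flip12 ∘ₗ coLeft
        (δ r) ∘ₗ Δp r := by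
  refine LinearMap.ext fun x => ?_
  have key := biadditive_self_eq_zero (fun t t' : A ⊗[k] A =>
      coRight (δ t) (Δp t' x) - flip23
        (coRight (δ t) (Δp t' x))
        -
          (flip12 (coRight (Δp t) (δ t' x)) - flip12
            (coLeft (δ t) (Δp t' x)))
        + coRight (δ (t - flip2 t) ∘ₗ succ x) t'
        - coRight ((succ x).lTensor A ∘ₗ δ (t - flip2 t)) t'
        + ((ast x).rTensor A).lTensor A (flip23 (dForm succ prec t t'))
        + ((succ x).lTensor A).lTensor A (sForm ast t t' - flip23 (sForm ast t t'))
        - coRight (actLeft ast.flip (Δp (t - flip2 t) x)) t'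
        - ((succ + prec).flip x).rTensor _ (sForm ast t t' - flip23 (sForm ast t t'))
        - flip12 (coLeft (δ (t - flip2 t)) (Δp t' x))
        + flip12 (coRight (Δp t') (δ (t - flip2 t) x))) ?_ ?_ r
  · simp only [hr.forms_self, hs.coproducts_eq_zero, LinearMap.zero_apply, LinearMap.comp_zero,
      LinearMap.zero_comp, map_zero, operators_zero, sub_zero, add_zero] at key
    exact sub_eq_zero.mp key
  · intro t u v
    refine ⟨?_, ?_⟩ <;> simp only [add_sub_add_comm, map_add, coproducts_add, operators_add,
      LinearMap.add_apply, LinearMap.comp_add, LinearMap.add_comp] <;> abel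
  · intro a b c d
    refine ⟨?_, ?_⟩ <;> simp only [map_add, map_sub, flip2_tmul, flip12_tmul, flip23_tmul,
      coproducts_sub, coproducts_tmul, operators_apply, dForm_tmul, sForm_tmul, assoc_tmul,
      LinearMap.comp_apply, linearMap_apply, LinearMap.flip_apply, rTensor_tmul, lTensor_tmul,
      tmul_distrib, h.rewriting, h.left_comm a x, h.left_comm b x, h.left_comm c x, h.left_comm d x,
      h.left_comm a c, h.left_comm a d] <;> abel

set_option maxHeartbeats 400000 in
lemma IsCoherentNCPrePoisson.coLeft_coDot_coAst (h : IsCoherentNCPrePoisson succ prec ast)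
    (hr : IsNPPYBESolution succ prec ast r)
    (hs : IsInvariant succ prec ast (r - flip2 r)) :
    coLeft (Δs r) ∘ₗ δ r + coLeft (Δp r) ∘ₗ δ r
      = flip23 ∘ₗ coLeft (δ r) ∘ₗ Δp r + coRight
        (δ r) ∘ₗ Δs r := by
  refine LinearMap.ext fun x => ?_
  have key := biadditive_self_eq_zero (fun t t' : A ⊗[k] A =>
      coLeft (Δs t) (δ t' x) + coLeft (Δp t) (δ t' x)
        -
          (flip23 (coLeft (δ t) (Δp t' x)) + coRight (δ t)
            (Δs t' x))
        - flip23 (flip12 (coLeft ((comm ast x).rTensor A ∘ₗ Δp (t - flip2 t)) t'))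
        - coRight ((comm ast x).lTensor A ∘ₗ Δs (t - flip2 t)) t'
        + ((comm ast x).lTensor A).lTensor A (flip23 (flip12 (dForm succ prec t t')))
        + ((succ x).rTensor A).lTensor A (sForm ast t t')
        - (prec.flip x).rTensor _ (sForm ast t t')
        - coLeft (actLeft ast.flip (Δp (t - flip2 t) x)) t'
        + flip23 (coLeft (δ t') (Δp (t - flip2 t) x))
        - coLeft (Δs (t - flip2 t)) (δ t' x)
        + coRight (δ t') (Δs (t - flip2 t) x)) ?_ ?_ r
  · simp only [hr.forms_self, hs.coproducts_eq_zero, LinearMap.zero_apply, LinearMap.comp_zero,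
      map_zero, operators_zero, sub_zero, add_zero] at key
    exact sub_eq_zero.mp key
  · intro t u v
    refine ⟨?_, ?_⟩ <;> simp only [add_sub_add_comm, map_add, coproducts_add, operators_add,
      LinearMap.add_apply, LinearMap.comp_add] <;> abel
  · intro a b c d
    refine ⟨?_, ?_⟩ <;> simp only [map_add, map_sub, flip2_tmul, flip12_tmul, flip23_tmul,
      coproducts_sub, coproducts_tmul, operators_apply, dForm_tmul, sForm_tmul, assoc_tmul,
      comm_apply, LinearMap.comp_apply, linearMap_apply, LinearMap.flip_apply, rTensor_tmul,
      lTensor_tmul, tmul_distrib, h.rewriting, h.left_comm a x, h.left_comm b x, h.left_comm c x,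
      h.left_comm d x, h.left_comm b a, h.left_comm a c, h.left_comm a d, h.left_comm b c,
      h.left_comm b d] <;> abel

set_option maxHeartbeats 400000 in
-- Only `D` is needed: the defect comes from `L_∗(x)` on the first two legs and `ad(x)` on the
-- third, applied to a cyclic permutation of `D`, up to invariance terms.
lemma IsCoherentNCPrePoisson.coLeft_coDot_coAst_eq_coRight (h : IsCoherentNCPrePoisson succ prec
  ast)
    (hr : IsNPPYBESolution succ prec ast r)
    (hs : IsInvariant succ prec ast (r - flip2 r)) :
    coLeft (Δs r) ∘ₗ δ r + coLeft (Δp r) ∘ₗ δ r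
      = coRight (Δs r) ∘ₗ δ r + flip12 ∘ₗ flip23 ∘ₗ coRight
        (Δp r) ∘ₗ δ r := by
  refine LinearMap.ext fun x => ?_
  have key := biadditive_self_eq_zero (fun t t' : A ⊗[k] A =>
      coLeft (Δs t) (δ t' x) + coLeft (Δp t) (δ t' x)
        -
          (coRight (Δs t) (δ t' x) + flip12
            (flip23 (coRight (Δp t) (δ t' x))))
        + (ast x).rTensor _ (flip23 (flip12 (dForm succ prec t t')))
        + ((ast x).rTensor A).lTensor A (flip23 (flip12 (dForm succ prec t t')))
        + ((comm ast x).lTensor A).lTensor A (flip23 (flip12 (dForm succ prec t t')))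
        + flip23 (flip12 (coRight (actRight prec (δ (t - flip2 t) x)) t'))
        - flip23 (coLeft (actLeft succ (δ (t - flip2 t) x)) t')
        - coRight (actLeft prec.flip (δ (t - flip2 t) x)) t'
        - coLeft (Δs (t - flip2 t)) (δ t' x)
        + flip12 (flip23 (coRight (Δp t') (δ (t - flip2 t) x)))
        + coRight (Δs t') (δ (t - flip2 t) x)) ?_ ?_ r
  · simp only [hr.forms_self, hs.coproducts_eq_zero, LinearMap.zero_apply, map_zero, operators_zero,
      sub_zero, add_zero] at key
    exact sub_eq_zero.mp key
  · intro t u v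
    refine ⟨?_, ?_⟩ <;> simp only [add_sub_add_comm, map_add, coproducts_add, operators_add,
      LinearMap.add_apply] <;> abel
  · intro a b c d
    refine ⟨?_, ?_⟩ <;> simp only [map_add, map_sub, flip2_tmul, flip12_tmul, flip23_tmul,
      coproducts_sub, coproducts_tmul, operators_apply, dForm_tmul, assoc_tmul, comm_apply,
      linearMap_apply, LinearMap.flip_apply, rTensor_tmul, lTensor_tmul, tmul_distrib, h.rewriting,
      h.left_comm a x, h.left_comm c x, h.left_comm a c, h.left_comm a d] <;> abel

end Coalgebra

/-! ### Compatibility conditions, linear in `r` -/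

section Compatibility

variable {succ prec ast : A →ₗ[k] A →ₗ[k] A} {r : A ⊗[k] A}

local notation "Δs" => coSucc succ prec
local notation "Δp" => coPrec succ prec
local notation "δ" => coAst ast

/-- The conditions `prec_dot`, `succ_dot` and `mixed₁` hold for every tensor; the other three hold
modulo coproducts of `r - flip2 r`. -/
lemma IsCoherentNCPrePoisson.dendriformCompat (h : IsCoherentNCPrePoisson succ prec ast)
    (hs : IsInvariant succ prec ast (r - flip2 r)) :
    DendriformCompat succ prec (Δs r) (Δp r) where
  prec_dot x y := by
    have key := additive_eq_zero (fun t : A ⊗[k] A =>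
        Δp t ((succ + prec) x y)
        - ((succ x).lTensor A (Δp t y) + ((succ + prec).flip y).rTensor A
          (Δp t x))) ?_ ?_ r
    · exact sub_eq_zero.mp key
    · intro t u
      simp only [add_sub_add_comm, map_add, coproducts_add, LinearMap.add_apply]
      abel
    · intro a b
      simp only [map_add, map_sub, coproducts_tmul, linearMap_apply, LinearMap.flip_apply,
        rTensor_tmul, lTensor_tmul, tmul_distrib, h.rewriting]
      abel
  succ_dot x y := by
    have key := additive_eq_zero (fun t : A ⊗[k] A =>
        Δs t ((succ + prec) x y)
        - (((succ + prec) x).lTensor A (Δs t y) + (prec.flip y).rTensor A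
          (Δs t x))) ?_ ?_ r
    · exact sub_eq_zero.mp key
    · intro t u
      simp only [add_sub_add_comm, map_add, coproducts_add, LinearMap.add_apply]
      abel
    · intro a b
      simp only [map_add, map_sub, coproducts_tmul, linearMap_apply, LinearMap.flip_apply,
        rTensor_tmul, lTensor_tmul, tmul_distrib, h.rewriting]
      abel
  dot_prec x y := by
    have key := additive_eq_zero (fun t : A ⊗[k] A =>
        (Δs t + Δp t) (prec x y)
        - ((prec.flip y).rTensor A ((Δs t + Δp t) x)
          + (prec x).lTensor A (Δs t y))
          + Δs (t - flip2 t) (succ x y)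
          - (succ x).lTensor A (Δs (t - flip2 t) y)) ?_ ?_ r
    · simp only [hs.coproducts_eq_zero, LinearMap.zero_apply, map_zero, sub_zero, add_zero] at key
      exact sub_eq_zero.mp key
    · intro t u
      simp only [add_sub_add_comm, map_add, coproducts_add, LinearMap.add_apply]
      abel
    · intro a b
      simp only [map_add, map_sub, flip2_tmul, coproducts_sub, coproducts_tmul, linearMap_apply,
        LinearMap.flip_apply, rTensor_tmul, lTensor_tmul, tmul_distrib, h.rewriting]
      abel
  dot_succ x y := by
    -- The corrections are opposite to those of `dot_prec`, as they must be: the sum of the two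
    -- conditions is the sum of `prec_dot` and `succ_dot`, which needs no correction.
    have key := additive_eq_zero (fun t : A ⊗[k] A =>
        (Δs t + Δp t) (succ x y)
        - ((succ x).lTensor A ((Δs t + Δp t) y)
          + (succ.flip y).rTensor A (Δp t x))
          - Δs (t - flip2 t) (succ x y)
          + (succ x).lTensor A (Δs (t - flip2 t) y)) ?_ ?_ r
    · simp only [hs.coproducts_eq_zero, LinearMap.zero_apply, map_zero, sub_zero, add_zero] at key
      exact sub_eq_zero.mp key
    · intro t u
      simp only [add_sub_add_comm, map_add, coproducts_add, LinearMap.add_apply]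
      abel
    · intro a b
      simp only [map_add, map_sub, flip2_tmul, coproducts_sub, coproducts_tmul, linearMap_apply,
        LinearMap.flip_apply, rTensor_tmul, lTensor_tmul, tmul_distrib, h.rewriting]
      abel
  mixed₁ x y := by
    have key := additive_eq_zero (fun t : A ⊗[k] A =>
        ((succ + prec) x).rTensor A (Δp t y) - (prec.flip x).lTensor A
          (Δp t y)
          + flip2 ((succ y).rTensor A (Δs t x) - ((succ + prec).flip y).lTensor A
            (Δs t x))) ?_ ?_ r
    · exact key
    · intro t u
      simp only [add_sub_add_comm, map_add, coproducts_add, LinearMap.add_apply]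
      abel
    · intro a b
      simp only [map_add, map_sub, flip2_tmul, coproducts_tmul, linearMap_apply,
        LinearMap.flip_apply, rTensor_tmul, lTensor_tmul, tmul_distrib, h.rewriting]
      abel
  mixed₂ x y := by
    have key := additive_eq_zero (fun t : A ⊗[k] A =>
        (succ x).rTensor A ((Δs t + Δp t) y) - (succ.flip y).rTensor A
          (flip2 (Δs t x))
          + (prec y).lTensor A (flip2 (Δp t x))
            - (prec.flip x).lTensor A ((Δs t + Δp t) y)
          + (prec x).rTensor A (Δp (t - flip2 t) y)
          + (succ y).lTensor A (flip2 (Δs (t - flip2 t) x))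
          - (prec.flip y).rTensor A (flip2 (Δs (t - flip2 t) x))) ?_ ?_ r
    · simp only [hs.coproducts_eq_zero, LinearMap.zero_apply, map_zero, sub_zero, add_zero] at key
      exact key
    · intro t u
      simp only [add_sub_add_comm, map_add, coproducts_add, LinearMap.add_apply]
      abel
    · intro a b
      simp only [map_add, map_sub, flip2_tmul, coproducts_sub, coproducts_tmul, linearMap_apply,
        LinearMap.flip_apply, rTensor_tmul, lTensor_tmul, tmul_distrib, h.rewriting]
      abel

lemma IsCoherentNCPrePoisson.isPreLieBialg (h : IsCoherentNCPrePoisson succ prec ast)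
    (hr : IsNPPYBESolution succ prec ast r)
    (hs : IsInvariant succ prec ast (r - flip2 r)) :
    IsPreLieBialg ast (δ r) where
  alg := h.preLie
  coalg := h.isPreLieCoalg_coAst hr hs
  cocycle x y := by
    have key := additive_eq_zero (fun t : A ⊗[k] A =>
        δ t (ast x y - ast y x)
        - (((comm ast x).lTensor A (δ t y) + (ast x).rTensor A (δ t y))
          - ((comm ast y).lTensor A (δ t x) + (ast y).rTensor A (δ t x)))) ?_ ?_ r
    · exact sub_eq_zero.mp key
    · intro t u
      simp only [add_sub_add_comm, map_add, coproducts_add, LinearMap.add_apply]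
      abel
    · intro a b
      simp only [map_add, map_sub, coproducts_tmul, comm_apply, rTensor_tmul, lTensor_tmul,
        tmul_distrib, h.left_comm y x, h.left_comm b x, h.left_comm b y]
      abel
  co_cocycle x y := by
    have key := additive_eq_zero (fun t : A ⊗[k] A =>
        (δ t - flip2 ∘ₗ δ t) (ast x y)
        - ((ast x).rTensor A ((δ t - flip2 ∘ₗ δ t) y)
          + (ast x).lTensor A ((δ t - flip2 ∘ₗ δ t) y)
          + (ast.flip y).lTensor A (δ t x) - (ast.flip y).rTensor A (flip2 (δ t x)))
          + (ast y).rTensor A (δ (t - flip2 t) x)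
          + (ast y).lTensor A (δ (t - flip2 t) x)
          - δ (t - flip2 t) (ast y x)
          + (ast.flip x).lTensor A (δ (t - flip2 t) y)) ?_ ?_ r
    · simp only [hs.coproducts_eq_zero, LinearMap.zero_apply, map_zero, sub_zero, add_zero] at key
      exact sub_eq_zero.mp key
    · intro t u
      simp only [add_sub_add_comm, map_add, coproducts_add, LinearMap.add_apply,
        LinearMap.sub_apply, LinearMap.comp_apply]
      abel
    · intro a b
      simp only [map_add, map_sub, flip2_tmul, coproducts_sub, coproducts_tmul,
        LinearMap.comp_apply, linearMap_apply, LinearMap.flip_apply, rTensor_tmul, lTensor_tmul,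
        tmul_distrib, h.left_comm y x, h.left_comm a y, h.left_comm b x, h.left_comm b y]
      abel

set_option maxHeartbeats 800000 in
-- The four mixed conditions follow from the invariance of `r - flip2 r` and the algebra axioms; the
-- Yang-Baxter equation serves only the coalgebra axioms.
lemma IsCoherentNCPrePoisson.isNCPrePoissonBialg (h : IsCoherentNCPrePoisson succ prec ast)
    (hr : IsNPPYBESolution succ prec ast r)
    (hs : IsInvariant succ prec ast (r - flip2 r)) :
    IsNCPrePoissonBialg succ prec ast
      (Δs r) (Δp r) (δ r) where
  alg := h
  coalg :=
    { dendriform := h.isDendriformCoalg hr hs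
      preLie := h.isPreLieCoalg_coAst hr hs
      comm_succ := h.coLeft_coAst_coSucc hr hs
      prec_comm := h.coRight_coAst_coPrec hr hs
      dot_ast := h.coLeft_coDot_coAst hr hs
      coherent := h.coLeft_coDot_coAst_eq_coRight hr hs }
  dendriform :=
    { alg := h.dendriform
      coalg := h.isDendriformCoalg hr hs
      compat := h.dendriformCompat hs }
  preLie := h.isPreLieBialg hr hs
  compat₁ x y := by
    have key := additive_eq_zero (fun t : A ⊗[k] A =>
        (Δs t + Δp t) (ast x y)
        - ((ast x).rTensor A ((Δs t + Δp t) y)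
          + (ast x).lTensor A ((Δs t + Δp t) y)
          - (prec y).lTensor A (δ t x) - (succ.flip y).rTensor A (flip2 (δ t x)))
          + (ast x).lTensor A (Δs (t - flip2 t) y)
          + (ast x).rTensor A (Δs (t - flip2 t) y)
          - (succ.flip y).rTensor A (flip2 (δ (t - flip2 t) x))
          - Δs (t - flip2 t) (ast x y)) ?_ ?_ r
    · simp only [hs.coproducts_eq_zero, LinearMap.zero_apply, map_zero, sub_zero, add_zero] at key
      exact sub_eq_zero.mp key
    · intro t u
      simp only [add_sub_add_comm, map_add, coproducts_add, LinearMap.add_apply]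
      abel
    · intro a b
      simp only [map_add, map_sub, flip2_tmul, coproducts_sub, coproducts_tmul, linearMap_apply,
        LinearMap.flip_apply, rTensor_tmul, lTensor_tmul, tmul_distrib, h.rewriting, h.left_comm y x,
        h.left_comm a x]
      abel
  compat₂ x y := by
    have key := additive_eq_zero (fun t : A ⊗[k] A =>
        (δ t - flip2 ∘ₗ δ t) (prec y x)
        - ((prec.flip x).lTensor A ((δ t - flip2 ∘ₗ δ t) y) + (ast.flip y).rTensor A
          (flip2 (Δs t x))
          + (prec y).lTensor A (δ t x)
            - (ast x).rTensor A ((Δs t + Δp t) y))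
          - (ast x).rTensor A (Δs (t - flip2 t) y)
          - (prec.flip x).lTensor A (flip2 (δ (t - flip2 t) y))
          + flip2 (δ (t - flip2 t) (prec y x))) ?_ ?_ r
    · simp only [hs.coproducts_eq_zero, LinearMap.zero_apply, map_zero, sub_zero, add_zero] at key
      exact sub_eq_zero.mp key
    · intro t u
      simp only [add_sub_add_comm, map_add, coproducts_add, LinearMap.add_apply, LinearMap.sub_apply,
        LinearMap.comp_apply]
      abel
    · intro a b
      simp only [map_add, map_sub, flip2_tmul, coproducts_sub, coproducts_tmul, LinearMap.comp_apply,
        linearMap_apply, LinearMap.flip_apply, rTensor_tmul, lTensor_tmul, tmul_distrib, h.rewriting,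
        h.left_comm a x]
      abel
  compat₃ x y := by
    have key := additive_eq_zero (fun t : A ⊗[k] A =>
        δ t ((succ + prec) x y)
        - (((succ + prec).flip y).lTensor A (δ t x) + ((succ + prec) x).lTensor A
          (δ t y)
          - (ast x).rTensor A (flip2 (Δp t y)) - (ast y).rTensor A
            (Δs t x))
          - (ast y).rTensor A (Δs (t - flip2 t) x)
          - (ast x).rTensor A (flip2 (Δp (t - flip2 t) y))) ?_ ?_ r
    · simp only [hs.coproducts_eq_zero, LinearMap.zero_apply, map_zero, sub_zero] at key
      exact sub_eq_zero.mp key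
    · intro t u
      simp only [add_sub_add_comm, map_add, coproducts_add, LinearMap.add_apply]
      abel
    · intro a b
      simp only [map_add, map_sub, flip2_tmul, coproducts_sub, coproducts_tmul, linearMap_apply,
        LinearMap.flip_apply, rTensor_tmul, lTensor_tmul, tmul_distrib, h.rewriting, h.left_comm y x]
      abel
  compat₄ x y := by
    have key := additive_eq_zero (fun t : A ⊗[k] A =>
        Δp t (ast x y - ast y x)
        - ((comm ast x).rTensor A (Δp t y) + (succ y).lTensor A (flip2 (δ t x))
          + (ast x).lTensor A (Δp t y) - ((succ + prec).flip y).rTensor A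
            (flip2 (δ t x)))
          - ((succ + prec).flip y).rTensor A (flip2 (δ (t - flip2 t) x))
          + (succ y).lTensor A (flip2 (δ (t - flip2 t) x))) ?_ ?_ r
    · simp only [hs.coproducts_eq_zero, LinearMap.zero_apply, map_zero, sub_zero, add_zero] at key
      exact sub_eq_zero.mp key
    · intro t u
      simp only [add_sub_add_comm, map_add, coproducts_add, LinearMap.add_apply]
      abel
    · intro a b
      simp only [map_add, map_sub, flip2_tmul, coproducts_tmul, coproducts_sub, comm_apply,
        linearMap_apply, LinearMap.flip_apply, rTensor_tmul, lTensor_tmul, tmul_distrib, h.rewriting,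
        h.left_comm y x, h.left_comm a x, h.left_comm a y]
      abel

end Compatibility

end PrePoisson

end

theorem mainTheorem4 {k A : Type*} [Field k] [AddCommGroup A] [Module k A]
    [FiniteDimensional k A] (succ prec ast : A →ₗ[k] A →ₗ[k] A)
    (hA : PrePoisson.IsCoherentNCPrePoisson succ prec ast) (r : A ⊗[k] A)
    (hr : PrePoisson.IsNPPYBESolution succ prec ast r)
    (hinv : PrePoisson.IsInvariant succ prec ast (r - PrePoisson.flip2 r)) :
    PrePoisson.IsNCPrePoissonBialg succ prec ast
      (PrePoisson.coSucc succ prec r) (PrePoisson.coPrec succ prec r)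
      (PrePoisson.coAst ast r) := by
  exact hA.isNCPrePoissonBialg hr hinv
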